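/- Let $T$ be a lattice in Euclidean space $E^3$, and let $p : E^3 \to T^3 = E^3/T$ be the covering map. Let $\Sigma_g$ be the closed orientable surface of genus $g \ge 0$, and let $e : \Sigma_g \hookrightarrow T^3$ be a topological embedding (for instance a smooth one). If $p^{-1}(e(\Sigma_g))$ is not connected, then $e$ is knotted; that is, there are no two subsets $V, W \subset T^3$ that are handlebodies (homeomorphic to a disc with finitely many holes times an interval, equivalently, to a 3-ball with finitely many orientable 1-handles attached) such that $V \cup W = T^3$ and $V \cap W = \partial V = \partial W = e(\Sigma_g)$. -/

import Mathlib

/-- Euclidean three-space. -/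
abbrev E3 : Type := EuclideanSpace ℝ (Fin 3)

/-- The flat three-torus `E³ / T`, with the quotient topology. -/
abbrev Torus3 (T : Submodule ℤ E3) : Type := E3 ⧸ T.toAddSubgroup

/-- The covering map `E³ → E³ / T`. -/
def torusCover (T : Submodule ℤ E3) : E3 → Torus3 T :=
  fun x => (QuotientAddGroup.mk x : E3 ⧸ T.toAddSubgroup)

/-- The planar disc with `g` holes: the closed disc of radius `g + 1` about `0`, from which the
pairwise disjoint open discs of radius `1/4` about the points `0, 1, …, g - 1` are removed. -/
def discWithHoles (g : ℕ) : Set ℂ :=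
  {z | ‖z‖ ≤ (g : ℝ) + 1 ∧ ∀ k : Fin g, 1 / 4 ≤ ‖z - ((k : ℕ) : ℂ)‖}

/-- The standard (orientable) handlebody of genus `g` in `ℝ³ = ℂ × ℝ`: the thickened disc with
`g` holes. It is a 3-ball for `g = 0`, a solid torus for `g = 1`, and in general a 3-ball with
`g` orientable 1-handles attached. -/
def stdHandlebody (g : ℕ) : Set (ℂ × ℝ) :=
  discWithHoles g ×ˢ Set.Icc (0 : ℝ) 1

/-- The standard closed orientable surface `Σ_g` of genus `g`: the boundary in `ℝ³` of the
standard handlebody of genus `g`. -/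
def stdSurface (g : ℕ) : Set (ℂ × ℝ) :=
  frontier (stdHandlebody g)

/-- The subset `V` of `X` is a handlebody (of some genus) whose boundary, as a manifold with
boundary, is `S`: some homeomorphism from a standard handlebody onto `V` takes the boundary of
the standard handlebody onto `S`. -/
def IsHandlebodyWithBoundary {X : Type*} [TopologicalSpace X] (V S : Set X) : Prop :=
  ∃ (h : ℕ) (f : stdHandlebody h → X), Topology.IsEmbedding f ∧ Set.range f = V ∧
    f '' {x | (x : ℂ × ℝ) ∈ stdSurface h} = S

/-- `S` splits `X` into two handlebodies: `X` is the union of two handlebodies that have `S` as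
their common boundary and meet exactly in `S`. -/
def SplitsIntoTwoHandlebodies {X : Type*} [TopologicalSpace X] (S : Set X) : Prop :=
  ∃ V W : Set X, IsHandlebodyWithBoundary V S ∧ IsHandlebodyWithBoundary W S ∧
    V ∪ W = Set.univ ∧ V ∩ W = S

/-- A map `e : Σ_g → X` (meant for embeddings) is unknotted if its image splits `X` into two
handlebodies. -/
def IsUnknotted {X : Type*} [TopologicalSpace X] {g : ℕ} (e : stdSurface g → X) : Prop :=
  SplitsIntoTwoHandlebodies (Set.range e)

/-- Knotted means not unknotted. -/
def IsKnotted {X : Type*} [TopologicalSpace X] {g : ℕ} (e : stdSurface g → X) : Prop :=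
  ¬ IsUnknotted e

/-! Suppose the surface S splits the torus into handlebodies V and W. A two-valued locally constant
function on the preimage of S extends over the preimages of V and of W
(`IsHandlebodyWithBoundary.exists_continuousOn_extension`). These preimages are closed and cover E³,
so the extensions glue to a continuous function on E³, which is constant. Hence the preimage of S is
preconnected.

The extension uses V = D × I: lift the vertical segments and read the function at their bottom ends.
This plays the role of the surjection π₁(∂V) → π₁(V), with no fundamental groups involved. -/

/-- Let `f` embed the cylinder `D × I` into the base of a covering map. If every point of `D` can
be joined to a point of `B`, then a locally constant function on the preimage of
`D × {0} ∪ D × {1} ∪ B × I` extends to a locally constant function on the preimage of `D × I`. -/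
theorem IsCoveringMap.exists_continuousOn_extension_of_cylinder {E X D Z : Type*}
    [TopologicalSpace E] [TopologicalSpace X] [TopologicalSpace D] [TopologicalSpace Z]
    [DiscreteTopology Z] {p : E → X} (cov : IsCoveringMap p) {f : D × unitInterval → X}
    (hf : Topology.IsEmbedding f) {B : Set D} (hB : ∀ d, ∃ b ∈ B, Joined d b) {S : Set X}
    (hS : S = f '' {x | x.1 ∈ B ∨ x.2 = 0 ∨ x.2 = 1}) {c : E → Z}
    (hc : ContinuousOn c (p ⁻¹' S)) :
    ∃ c' : E → Z, ContinuousOn c' (p ⁻¹' Set.range f) ∧ Set.EqOn c' c (p ⁻¹' S) := by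
  classical
  have hSf : ∀ d t, d ∈ B ∨ t = 0 ∨ t = 1 → f (d, t) ∈ S := fun d t h ↦
    hS ▸ Set.mem_image_of_mem f h
  have const_path : ∀ g : unitInterval → E, Continuous g → (∀ s, g s ∈ p ⁻¹' S) →
      c (g 0) = c (g 1) := fun g hg hgS ↦
    isPreconnected_univ.constant (hc.comp_continuous hg hgS).continuousOn
      (Set.mem_univ 0) (Set.mem_univ 1)
  let φ : p ⁻¹' Set.range f → D × unitInterval := fun y ↦ hf.toHomeomorph.symm ⟨p y, y.2⟩
  have hφ : Continuous φ := hf.toHomeomorph.symm.continuous.comp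
    ((cov.continuous.comp continuous_subtype_val).subtype_mk _)
  have hfφ : ∀ y, f (φ y) = p y := fun y ↦
    congrArg Subtype.val (hf.toHomeomorph.apply_symm_apply ⟨p y, y.2⟩)
  have hφf : ∀ y d t, p y = f (d, t) → ∀ hy, φ ⟨y, hy⟩ = (d, t) := fun y d t h hy ↦
    hf.injective ((hfφ _).trans h)
  -- The deformation sends (d, t) to (d, t(1 - s)), pushing the cylinder down to its bottom; `L`
  -- lifts it, starting from the inclusion.
  let H : C(unitInterval × (p ⁻¹' Set.range f), X) :=
    ⟨fun a ↦ f ((φ a.2).1, (φ a.2).2 * unitInterval.symm a.1), hf.continuous.comp (by fun_prop)⟩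
  have H_zero : ∀ y, H (0, y) = p ((⟨Subtype.val, continuous_subtype_val⟩ :
      C(p ⁻¹' Set.range f, E)) y) := fun y ↦ by
    simpa [H] using hfφ y
  let L := cov.liftHomotopy H ⟨Subtype.val, continuous_subtype_val⟩ H_zero
  have hL : ∀ s y, p (L (s, y)) = f ((φ y).1, (φ y).2 * unitInterval.symm s) := fun s y ↦
    congrFun (cov.liftHomotopy_lifts H _ H_zero) (s, y)
  have hL_zero : ∀ y, L (0, y) = y := fun y ↦ cov.liftHomotopy_zero H _ H_zero y
  have hL_one : ∀ y, L (1, y) ∈ p ⁻¹' S := fun y ↦ by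
    rw [Set.mem_preimage, hL]
    exact hSf _ _ (by simp)
  have hr : Continuous fun y ↦ c (L (1, y)) :=
    hc.comp_continuous (L.continuous.comp (by fun_prop)) hL_one
  -- Over the bottom and the side wall `B × I`, the lifted segment never leaves the preimage of `S`.
  have side : ∀ y, (φ y).1 ∈ B ∨ (φ y).2 = 0 → c y = c (L (1, y)) := fun y hy ↦ by
    rw [← hL_zero y]
    refine (const_path (fun s ↦ L (s, y)) (L.continuous.comp (by fun_prop)) fun s ↦ ?_).trans ?_
    · rw [Set.mem_preimage, hL]
      exact hSf _ _ (hy.imp id fun h ↦ .inl (by simp [h]))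
    · rfl
  refine ⟨fun x ↦ if h : x ∈ p ⁻¹' Set.range f then c (L (1, ⟨x, h⟩)) else c x, ?_, ?_⟩
  · rw [continuousOn_iff_continuous_domRestrict]
    convert! hr using 2 with y
    exact dif_pos y.2
  · intro x hx
    rw [Set.mem_preimage, hS] at hx
    obtain ⟨⟨d, t⟩, hdt, hx⟩ := hx
    have hxf : x ∈ p ⁻¹' Set.range f := ⟨_, hx⟩
    simp only [dif_pos hxf]
    have hφx := hφf x d t hx.symm hxf
    rcases hdt with h | h | h
    · exact (side ⟨x, hxf⟩ (.inl (hφx ▸ h))).symm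
    · exact (side ⟨x, hxf⟩ (.inr (hφx ▸ h))).symm
    -- From the top, the vertical segment may leave `S`. Detour instead: along the lift `Γ` of a top
    -- path to `B`, down the side wall, and back along the bottom endpoints of the segments from
    -- `Γ`.
    · obtain rfl : t = 1 := h
      obtain ⟨b, hb, ⟨γ⟩⟩ := hB d
      let γ' : C(unitInterval, X) := ⟨fun s ↦ f (γ s, 1), hf.continuous.comp (by fun_prop)⟩
      have hγ' : γ' 0 = p x := by simpa [γ'] using hx
      let Γ := cov.liftPath γ' x hγ'
      have hΓ : ∀ s, p (Γ s) = f (γ s, 1) := congrFun (cov.liftPath_lifts γ' x hγ')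
      have hΓ0 : Γ 0 = x := cov.liftPath_zero γ' x hγ'
      have hΓf : ∀ s, Γ s ∈ p ⁻¹' Set.range f := fun s ↦ ⟨_, (hΓ s).symm⟩
      have hend : c (Γ 1) = c (L (1, ⟨Γ 1, hΓf 1⟩)) :=
        side ⟨Γ 1, hΓf 1⟩ (.inl (by rw [hφf _ _ _ (hΓ 1)]; simpa using hb))
      have htop : c (Γ 0) = c (Γ 1) := const_path Γ Γ.continuous fun s ↦ by
        rw [Set.mem_preimage, hΓ]
        exact hSf _ _ (by simp)
      have hbot : c (L (1, ⟨Γ 0, hΓf 0⟩)) = c (L (1, ⟨Γ 1, hΓf 1⟩)) :=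
        isPreconnected_univ.constant (f := fun s ↦ c (L (1, ⟨Γ s, hΓf s⟩)))
          (hr.comp (Γ.continuous.subtype_mk hΓf)).continuousOn (Set.mem_univ 0) (Set.mem_univ 1)
      have h0 : c (L (1, ⟨x, hxf⟩)) = c (L (1, ⟨Γ 0, hΓf 0⟩)) := by simp only [hΓ0]
      rw [h0, hbot, ← hend, ← htop, hΓ0]

/-- If two closed sets cover a preconnected space, and every locally constant function on their
intersection extends to a locally constant function on each of them, then the intersection is
preconnected. -/
theorem IsClosed.isPreconnected_inter_of_extension {E : Type*} [TopologicalSpace E]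
    [PreconnectedSpace E] {V W : Set E} (hV : IsClosed V) (hW : IsClosed W)
    (hVW : V ∪ W = Set.univ)
    (extV : ∀ c : E → Bool, ContinuousOn c (V ∩ W) →
      ∃ c', ContinuousOn c' V ∧ Set.EqOn c' c (V ∩ W))
    (extW : ∀ c : E → Bool, ContinuousOn c (V ∩ W) →
      ∃ c', ContinuousOn c' W ∧ Set.EqOn c' c (V ∩ W)) :
    IsPreconnected (V ∩ W) := by
  classical
  refine isPreconnected_of_forall_constant fun c hc x hx y hy ↦ ?_
  obtain ⟨a, ha, hac⟩ := extV c hc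
  obtain ⟨b, hb, hbc⟩ := extW c hc
  have hpV : Set.EqOn (V.piecewise a b) a V := Set.piecewise_eqOn V a b
  have hpW : Set.EqOn (V.piecewise a b) b W := fun z hz ↦ by
    by_cases hzV : z ∈ V
    · rw [hpV hzV, hac ⟨hzV, hz⟩, hbc ⟨hzV, hz⟩]
    · exact Set.piecewise_eq_of_notMem V a b hzV
  have hcont : ContinuousOn (V.piecewise a b) Set.univ :=
    hVW ▸ (ha.congr hpV).union_of_isClosed (hb.congr hpW) hV hW
  rw [← hac hx, ← hac hy, ← hpV hx.1, ← hpV hy.1]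
  exact isPreconnected_univ.constant hcont (Set.mem_univ x) (Set.mem_univ y)

/-- In a proper real normed space, a point of a closed set with nonempty complement is joined
within the set to a point of its frontier. -/
theorem IsClosed.exists_mem_frontier_joinedIn {F : Type*} [NormedAddCommGroup F]
    [NormedSpace ℝ F] [ProperSpace F] {D : Set F} (hD : IsClosed D) (hne : Dᶜ.Nonempty) {d : F}
    (hd : d ∈ D) : ∃ b ∈ frontier D, JoinedIn D d b := by
  -- Take `b` nearest to `d` in the closure of the complement: the closed ball about `d` through `b`
  -- lies in `D`, hence so does the segment.
  obtain ⟨b, hb, hbd⟩ := Metric.exists_mem_closure_infDist_eq_dist hne d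
  have hball : Metric.closedBall d (Metric.infDist d Dᶜ) ⊆ D :=
    (Metric.closedBall_infDist_compl_subset_closure hd).trans hD.closure_eq.subset
  have hbball : b ∈ Metric.closedBall d (Metric.infDist d Dᶜ) := by
    rw [Metric.mem_closedBall, hbd, dist_comm]
  refine ⟨b, ?_, JoinedIn.of_segment_subset (((convex_closedBall d _).segment_subset
    (Metric.mem_closedBall_self Metric.infDist_nonneg) hbball).trans hball)⟩
  rw [frontier_eq_closure_inter_closure]
  exact ⟨subset_closure (hball hbball), hb⟩

theorem isClosed_discWithHoles (g : ℕ) : IsClosed (discWithHoles g) := by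
  simp only [discWithHoles, Set.ofPred_and, Set.ofPred_forall]
  exact (isClosed_le (by fun_prop) (by fun_prop)).inter
    (isClosed_iInter fun k ↦ isClosed_le (by fun_prop) (by fun_prop))

theorem isCompact_discWithHoles (g : ℕ) : IsCompact (discWithHoles g) :=
  (isCompact_closedBall (0 : ℂ) ((g : ℝ) + 1)).of_isClosed_subset (isClosed_discWithHoles g)
    fun _ hz ↦ mem_closedBall_zero_iff.mpr hz.1

theorem nonempty_compl_discWithHoles (g : ℕ) : (discWithHoles g)ᶜ.Nonempty :=
  Set.nonempty_compl.mpr (isCompact_discWithHoles g).ne_univ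

theorem isCompact_stdHandlebody (g : ℕ) : IsCompact (stdHandlebody g) :=
  (isCompact_discWithHoles g).prod isCompact_Icc

/-- This is the bottom, top and side wall required by the cylinder lemma. -/
theorem stdSurface_eq (g : ℕ) : stdSurface g =
    discWithHoles g ×ˢ {0, 1} ∪ frontier (discWithHoles g) ×ˢ Set.Icc (0 : ℝ) 1 := by
  rw [stdSurface, stdHandlebody, frontier_prod_eq, (isClosed_discWithHoles g).closure_eq,
    closure_Icc, frontier_Icc zero_le_one]

theorem stdSurface_nonempty (g : ℕ) : (stdSurface g).Nonempty := by
  -- The rightmost point of the outer circle, at distance more than 1 from every hole centre.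
  have hmem : (((g : ℝ) + 1 : ℝ) : ℂ) ∈ discWithHoles g := by
    refine ⟨by rw [Complex.norm_of_nonneg (by positivity)], fun k ↦ ?_⟩
    have hk : ((k : ℕ) : ℝ) < g := by exact_mod_cast k.2
    rw [← Complex.ofReal_natCast, ← Complex.ofReal_sub,
      Complex.norm_of_nonneg (by linarith)]
    linarith
  rw [stdSurface_eq]
  exact ⟨(_, 0), Or.inl ⟨hmem, Or.inl rfl⟩⟩

theorem IsHandlebodyWithBoundary.isClosed {X : Type*} [TopologicalSpace X] [T2Space X]
    {V S : Set X} (h : IsHandlebodyWithBoundary V S) : IsClosed V := by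
  obtain ⟨g, f, hf, rfl, -⟩ := h
  have := isCompact_iff_compactSpace.mp (isCompact_stdHandlebody g)
  exact (isCompact_range hf.continuous).isClosed

/-- A locally constant function on the preimage of the boundary of a handlebody under a covering
map extends to the preimage of the handlebody. -/
theorem IsHandlebodyWithBoundary.exists_continuousOn_extension {E X Z : Type*}
    [TopologicalSpace E] [TopologicalSpace X] [TopologicalSpace Z] [DiscreteTopology Z]
    {p : E → X} (cov : IsCoveringMap p) {V S : Set X} (h : IsHandlebodyWithBoundary V S)
    {c : E → Z} (hc : ContinuousOn c (p ⁻¹' S)) :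
    ∃ c' : E → Z, ContinuousOn c' (p ⁻¹' V) ∧ Set.EqOn c' c (p ⁻¹' S) := by
  obtain ⟨g, f, hf, rfl, hS⟩ := h
  let ψ : discWithHoles g × unitInterval ≃ₜ stdHandlebody g :=
    (Homeomorph.Set.prod (discWithHoles g) (Set.Icc (0 : ℝ) 1)).symm
  have hψ : ∀ x, (ψ x : ℂ × ℝ) = ((x.1 : ℂ), (x.2 : ℝ)) := fun _ ↦ rfl
  rw [← ψ.surjective.range_comp f]
  refine cov.exists_continuousOn_extension_of_cylinder (hf.comp ψ.isEmbedding)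
    (B := Subtype.val ⁻¹' frontier (discWithHoles g)) (fun d ↦ ?_) ?_ hc
  · obtain ⟨b, hb, hdb⟩ := (isClosed_discWithHoles g).exists_mem_frontier_joinedIn
      (nonempty_compl_discWithHoles g) d.2
    exact ⟨⟨b, hdb.target_mem⟩, hb, hdb.joined_subtype⟩
  · rw [← hS, Set.image_comp, ← Homeomorph.preimage_symm]
    congr 1
    ext x
    obtain ⟨⟨⟨d, hd⟩, ⟨t, ht⟩⟩, rfl⟩ := ψ.surjective x
    simp only [Set.mem_ofPred_eq, Set.mem_preimage, Homeomorph.symm_apply_apply, hψ,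
      stdSurface_eq, Set.mem_union, Set.mem_prod, Set.mem_insert_iff, Set.mem_singleton_iff,
      hd, ht, true_and, and_true, Subtype.ext_iff, Set.Icc.coe_zero, Set.Icc.coe_one]
    exact or_comm

/-- If a set splits a Hausdorff space into two handlebodies, its preimage under a covering map
with connected total space is preconnected. -/
theorem SplitsIntoTwoHandlebodies.isPreconnected_preimage {E X : Type*} [TopologicalSpace E]
    [PreconnectedSpace E] [TopologicalSpace X] [T2Space X] {p : E → X} (cov : IsCoveringMap p)
    {S : Set X} (h : SplitsIntoTwoHandlebodies S) : IsPreconnected (p ⁻¹' S) := by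
  obtain ⟨V, W, hV, hW, hun, rfl⟩ := h
  rw [Set.preimage_inter]
  exact (hV.isClosed.preimage cov.continuous).isPreconnected_inter_of_extension
    (hW.isClosed.preimage cov.continuous) (by rw [← Set.preimage_union, hun, Set.preimage_univ])
    (fun _ hc ↦ hV.exists_continuousOn_extension cov hc)
    (fun _ hc ↦ hW.exists_continuousOn_extension cov hc)

theorem isCoveringMap_torusCover (T : Submodule ℤ E3) [DiscreteTopology T] :
    IsCoveringMap (torusCover T) :=
  ((QuotientAddGroup.isQuotientMap_mk (N := T.toAddSubgroup)).isAddQuotientCoveringMap_of_addSubgroup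
    T.toAddSubgroup (isDiscrete_iff_discreteTopology.mpr ‹_›)
    fun {x y} ↦ by rw [QuotientAddGroup.eq, neg_add_eq_sub, sub_eq_add_neg]).isCoveringMap

theorem lemma5p1 (T : Submodule ℤ E3) [DiscreteTopology T] [IsZLattice ℝ T]
    (g : ℕ) (e : stdSurface g → Torus3 T) (he : Topology.IsEmbedding e)
    (hdisc : ¬ IsConnected (torusCover T ⁻¹' Set.range e)) :
    IsKnotted e := by
  intro h
  have : DiscreteTopology T.toAddSubgroup := ‹DiscreteTopology T›
  have : IsClosed (T.toAddSubgroup : Set E3) := AddSubgroup.isClosed_of_discrete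
  have : T2Space (Torus3 T) := inferInstance
  -- `IsConnected` also demands nonemptiness, which comes from a point of the surface.
  refine hdisc ⟨?_, h.isPreconnected_preimage (isCoveringMap_torusCover T)⟩
  obtain ⟨x, hx⟩ := stdSurface_nonempty g
  exact Set.Nonempty.preimage ⟨e ⟨x, hx⟩, Set.mem_range_self _⟩ QuotientAddGroup.mk_surjective
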